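/- Let $\mathcal H_1,\mathcal H_2$ be separable complex Hilbert spaces and let $\rho$ be a state (density operator, i.e. a positive trace class operator of trace $1$) on the Hilbert space tensor product $\mathcal H_1\otimes\mathcal H_2$. A source-operator for $\rho$ is a self-adjoint trace class operator $T_{122}$ on $\mathcal H_1\otimes\mathcal H_2\otimes\mathcal H_2$ whose partial trace over the second factor and whose partial trace over the third factor are both equal to $\rho$, or a self-adjoint trace class operator $T_{112}$ on $\mathcal H_1\otimes\mathcal H_1\otimes\mathcal H_2$ whose partial trace over the first factor and whose partial trace over the second factor are both equal to $\rho$. The state $\rho$ is called a density source-operator (DSO) state if it has a positive source-operator, of either of these two kinds. Theorem 1 (DSO states and the CHSH inequality). Let $\rho$ be a DSO state on $\mathcal H_1\otimes\mathcal H_2$. Then for all bounded self-adjoint operators $A_1,A_2$ on $\mathcal H_1$ and $B_1,B_2$ on $\mathcal H_2$, with spectra of any type and with operator norms $\le 1$, the trace below is well defined (the diagonal matrix entries of the operator under the trace are summable in every orthonormal basis of $\mathcal H_1\otimes\mathcal H_2$, with a sum that does not depend on the basis) and $$\bigl|\mathrm{tr}[\rho(A_1\otimes B_1+A_1\otimes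 B_2+A_2\otimes B_1-A_2\otimes B_2)]\bigr|\le 2 .$$ -/

import Mathlib

open scoped TensorProduct InnerProductSpace

noncomputable section

namespace DSO

universe u v w z

/-- The Hilbert space tensor product: the completion of the algebraic tensor product for the inner
product with `⟪x ⊗ y, x' ⊗ y'⟫ = ⟪x, x'⟫ * ⟪y, y'⟫`. -/
abbrev HTensor (E : Type u) (F : Type v)
    [NormedAddCommGroup E] [InnerProductSpace ℂ E]
    [NormedAddCommGroup F] [InnerProductSpace ℂ F] : Type (max u v) :=
  UniformSpace.Completion (E ⊗[ℂ] F)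

section Tensor

variable {E : Type u} {F : Type v} {E' : Type w} {F' : Type z}
  [NormedAddCommGroup E] [InnerProductSpace ℂ E]
  [NormedAddCommGroup F] [InnerProductSpace ℂ F]
  [NormedAddCommGroup E'] [InnerProductSpace ℂ E']
  [NormedAddCommGroup F'] [InnerProductSpace ℂ F']

/-- The bounded operator `A ⊗ B` on the Hilbert space tensor product: the continuous extension of
`x ⊗ y ↦ A x ⊗ B y`. -/
def tensorOp (A : E →L[ℂ] E') (B : F →L[ℂ] F') : HTensor E F →L[ℂ] HTensor E' F' :=
  (TensorProduct.mapL A B).completion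

/-- The operator `y ↦ e ⊗ y`. -/
def insertLeft (F : Type v) [NormedAddCommGroup F] [InnerProductSpace ℂ F] (e : E) :
    F →L[ℂ] HTensor E F :=
  UniformSpace.Completion.toComplL ∘L TensorProduct.mkL ℂ E F e

/-- The operator `x ↦ x ⊗ e`. -/
def insertRight (E : Type u) [NormedAddCommGroup E] [InnerProductSpace ℂ E] (e : F) :
    E →L[ℂ] HTensor E F :=
  UniformSpace.Completion.toComplL ∘L (TensorProduct.mkL ℂ E F).flip e

end Tensor

section Trace

variable (H : Type u) [NormedAddCommGroup H] [InnerProductSpace ℂ H] [CompleteSpace H]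

/-- The index set of `stdBasis H`. -/
def basisIndex : Set H := (exists_hilbertBasis ℂ H).choose

/-- Some orthonormal (Hilbert) basis of `H`, fixed once and for all. -/
def stdBasis : HilbertBasis (basisIndex H) ℂ H :=
  (exists_hilbertBasis ℂ H).choose_spec.choose

variable {H}

/-- `T` is trace class: `tr |T| < ∞`, where `|T| = (T* T)^(1/2)`. -/
def IsTraceClass (T : H →L[ℂ] H) : Prop :=
  Summable fun i : basisIndex H => ⟪stdBasis H i, CFC.abs T (stdBasis H i)⟫_ℂ

/-- The trace of a trace class operator. -/
def trace (T : H →L[ℂ] H) : ℂ :=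
  ∑' i : basisIndex H, ⟪stdBasis H i, T (stdBasis H i)⟫_ℂ

/-- In every orthonormal basis of `H` the diagonal matrix entries of `T` are summable,
with the same sum `t`. -/
def HasTrace (T : H →L[ℂ] H) (t : ℂ) : Prop :=
  ∀ (ι : Type u) (b : HilbertBasis ι ℂ H), HasSum (fun i => ⟪b i, T (b i)⟫_ℂ) t

/-- A (normal) quantum state, that is, a density operator: positive, trace class, of trace one. -/
structure IsState (ρ : H →L[ℂ] H) : Prop where
  isPositive : ρ.IsPositive
  isTraceClass : IsTraceClass ρ
  trace_eq_one : trace ρ = 1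

end Trace

section Source

variable {H₁ : Type u} {H₂ : Type v}
  [NormedAddCommGroup H₁] [InnerProductSpace ℂ H₁] [CompleteSpace H₁]
  [NormedAddCommGroup H₂] [InnerProductSpace ℂ H₂] [CompleteSpace H₂]

/-- `H₁ ⊗ H₂ ⊗ H₂`. -/
abbrev K122 (H₁ : Type u) (H₂ : Type v)
    [NormedAddCommGroup H₁] [InnerProductSpace ℂ H₁]
    [NormedAddCommGroup H₂] [InnerProductSpace ℂ H₂] : Type (max u v) :=
  HTensor H₁ (HTensor H₂ H₂)

/-- `H₁ ⊗ H₁ ⊗ H₂`. -/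
abbrev K112 (H₁ : Type u) (H₂ : Type v)
    [NormedAddCommGroup H₁] [InnerProductSpace ℂ H₁]
    [NormedAddCommGroup H₂] [InnerProductSpace ℂ H₂] : Type (max u v) :=
  HTensor (HTensor H₁ H₁) H₂

/-- For a trace class operator `T` on `H₁ ⊗ H₂ ⊗ H₂`, the partial trace over the second factor,
`∑ₖ Vₖ* T Vₖ` with `Vₖ (x ⊗ y) = x ⊗ eₖ ⊗ y`, for an orthonormal basis `eₖ` of `H₂`. The series
converges absolutely in operator norm. -/
def ptrace122₂ (T : K122 H₁ H₂ →L[ℂ] K122 H₁ H₂) : HTensor H₁ H₂ →L[ℂ] HTensor H₁ H₂ :=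
  ∑' k : basisIndex H₂,
    (tensorOp (.id ℂ H₁) (insertLeft H₂ (stdBasis H₂ k))).adjoint ∘L T ∘L
      tensorOp (.id ℂ H₁) (insertLeft H₂ (stdBasis H₂ k))

/-- For a trace class operator `T` on `H₁ ⊗ H₂ ⊗ H₂`, the partial trace over the third factor,
`∑ₖ Vₖ* T Vₖ` with `Vₖ (x ⊗ y) = x ⊗ y ⊗ eₖ`. -/
def ptrace122₃ (T : K122 H₁ H₂ →L[ℂ] K122 H₁ H₂) : HTensor H₁ H₂ →L[ℂ] HTensor H₁ H₂ :=
  ∑' k : basisIndex H₂,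
    (tensorOp (.id ℂ H₁) (insertRight H₂ (stdBasis H₂ k))).adjoint ∘L T ∘L
      tensorOp (.id ℂ H₁) (insertRight H₂ (stdBasis H₂ k))

/-- For a trace class operator `T` on `H₁ ⊗ H₁ ⊗ H₂`, the partial trace over the first factor,
`∑ₖ Vₖ* T Vₖ` with `Vₖ (x ⊗ y) = eₖ ⊗ x ⊗ y`, for an orthonormal basis `eₖ` of `H₁`. -/
def ptrace112₁ (T : K112 H₁ H₂ →L[ℂ] K112 H₁ H₂) : HTensor H₁ H₂ →L[ℂ] HTensor H₁ H₂ :=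
  ∑' k : basisIndex H₁,
    (tensorOp (insertLeft H₁ (stdBasis H₁ k)) (.id ℂ H₂)).adjoint ∘L T ∘L
      tensorOp (insertLeft H₁ (stdBasis H₁ k)) (.id ℂ H₂)

/-- For a trace class operator `T` on `H₁ ⊗ H₁ ⊗ H₂`, the partial trace over the second factor,
`∑ₖ Vₖ* T Vₖ` with `Vₖ (x ⊗ y) = x ⊗ eₖ ⊗ y`. -/
def ptrace112₂ (T : K112 H₁ H₂ →L[ℂ] K112 H₁ H₂) : HTensor H₁ H₂ →L[ℂ] HTensor H₁ H₂ :=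
  ∑' k : basisIndex H₁,
    (tensorOp (insertRight H₁ (stdBasis H₁ k)) (.id ℂ H₂)).adjoint ∘L T ∘L
      tensorOp (insertRight H₁ (stdBasis H₁ k)) (.id ℂ H₂)

/-- `T` on `H₁ ⊗ H₂ ⊗ H₂` is a source-operator for `ρ`. -/
structure IsSourceOp122 (ρ : HTensor H₁ H₂ →L[ℂ] HTensor H₁ H₂)
    (T : K122 H₁ H₂ →L[ℂ] K122 H₁ H₂) : Prop where
  isSelfAdjoint : IsSelfAdjoint T
  isTraceClass : IsTraceClass T
  ptrace_two : ptrace122₂ T = ρ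
  ptrace_three : ptrace122₃ T = ρ

/-- `T` on `H₁ ⊗ H₁ ⊗ H₂` is a source-operator for `ρ`. -/
structure IsSourceOp112 (ρ : HTensor H₁ H₂ →L[ℂ] HTensor H₁ H₂)
    (T : K112 H₁ H₂ →L[ℂ] K112 H₁ H₂) : Prop where
  isSelfAdjoint : IsSelfAdjoint T
  isTraceClass : IsTraceClass T
  ptrace_one : ptrace112₁ T = ρ
  ptrace_two : ptrace112₂ T = ρ

/-- A DSO state: a bipartite state with a density source-operator, that is, with a positive
source-operator of one of the two kinds. -/
structure IsDSOState (ρ : HTensor H₁ H₂ →L[ℂ] HTensor H₁ H₂) : Prop where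
  isState : IsState ρ
  exists_density : (∃ T : K122 H₁ H₂ →L[ℂ] K122 H₁ H₂, IsSourceOp122 ρ T ∧ T.IsPositive) ∨
    ∃ T : K112 H₁ H₂ →L[ℂ] K112 H₁ H₂, IsSourceOp112 ρ T ∧ T.IsPositive

/-- A bounded quantum observable of operator norm at most one. -/
structure IsUnitObservable (A : H₁ →L[ℂ] H₁) : Prop where
  isSelfAdjoint : IsSelfAdjoint A
  norm_le_one : ‖A‖ ≤ 1

/-- The operator `A₁ ⊗ B₁ + A₁ ⊗ B₂ + A₂ ⊗ B₁ - A₂ ⊗ B₂`. -/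
def chshOp (A₁ A₂ : H₁ →L[ℂ] H₁) (B₁ B₂ : H₂ →L[ℂ] H₂) :
    HTensor H₁ H₂ →L[ℂ] HTensor H₁ H₂ :=
  tensorOp A₁ B₁ + tensorOp A₁ B₂ + tensorOp A₂ B₁ - tensorOp A₂ B₂

end Source

end DSO

end

open scoped ComplexOrder

noncomputable section

namespace DSO

/-! ### Hilbert–Schmidt operators and exchange of double series. -/

section HilbertSchmidt

variable {H K ι κ : Type*}
  [NormedAddCommGroup H] [InnerProductSpace ℂ H]
  [NormedAddCommGroup K] [InnerProductSpace ℂ K]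

/-! A positive source-operator `T` on `H₁ ⊗ H₂ ⊗ H₂` gives `B₁` and `B₂` separate factors to act on:
`tr ρ(A ⊗ B)` equals both `tr T(A ⊗ B ⊗ 1)` and `tr T(A ⊗ 1 ⊗ B)`. Using the first form for `B₁` and
the second for `B₂`, all four correlations become values of one positive normalized functional on
products of commuting observables, and the classical bound 2 applies. It comes from writing `4 ∓
2w`, where `w` is the CHSH value, as a sum of four values at products of the positive operators `1 ±
a`, `1 ± x`, `1 ± y` (`norm_chsh_le_two`). The 112 case exchanges the roles of the two sides.

The analytic content is twofold. For positive trace class `T`, writing `T = √T √T` with `√T`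
Hilbert–Schmidt makes `tr(T D)` basis independent, and nonnegative for `D ≥ 0`. The isometries `Vₖ`
defining a partial trace carry a basis of the small space to a basis of the large one, which
transfers traces (`IsOrthogonalResolution.hasSum_inner_comp`). -/

theorem hasSum_sq_norm_inner (b : HilbertBasis ι ℂ H) (x : H) :
    HasSum (fun i => ‖⟪b i, x⟫_ℂ‖ ^ 2) (‖x‖ ^ 2) := by
  have h := b.hasSum_inner_mul_inner x x
  rw [inner_self_eq_norm_sq_to_K] at h
  have h' := Complex.hasSum_re h
  convert h' using 1
  · ext i
    rw [← inner_conj_symm x (b i), ← Complex.normSq_eq_conj_mul_self, Complex.ofReal_re,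
      Complex.normSq_eq_norm_sq]
  · norm_cast

/-- The matrix entries of a Hilbert–Schmidt operator are square summable. -/
theorem summable_sq_norm_inner_prod (b : HilbertBasis ι ℂ H) (c : HilbertBasis κ ℂ K)
    {X : H →L[ℂ] K} (hX : Summable fun i => ‖X (b i)‖ ^ 2) :
    Summable fun p : ι × κ => ‖⟪c p.2, X (b p.1)⟫_ℂ‖ ^ 2 := by
  refine (summable_prod_of_nonneg fun p => by positivity).2
    ⟨fun i => (hasSum_sq_norm_inner c (X (b i))).summable, ?_⟩
  exact hX.congr fun i => ((hasSum_sq_norm_inner c (X (b i))).tsum_eq).symm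

variable [CompleteSpace H] [CompleteSpace K]

/-- The adjoint of a Hilbert–Schmidt operator is Hilbert–Schmidt. -/
theorem summable_sq_norm_adjoint (b : HilbertBasis ι ℂ H) (c : HilbertBasis κ ℂ K)
    {X : H →L[ℂ] K} (hX : Summable fun i => ‖X (b i)‖ ^ 2) :
    Summable fun k => ‖X.adjoint (c k)‖ ^ 2 := by
  have h := ((Equiv.prodComm κ ι).summable_iff.2 (summable_sq_norm_inner_prod b c hX)).prod
  refine h.congr fun k => ?_
  rw [← (hasSum_sq_norm_inner b (X.adjoint (c k))).tsum_eq]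
  refine tsum_congr fun i => ?_
  simp [ContinuousLinearMap.adjoint_inner_right, norm_inner_symm]

/-- The Hilbert–Schmidt inner product can be computed in the codomain, with the adjoints. -/
theorem hasSum_inner_adjoint (b : HilbertBasis ι ℂ H) (c : HilbertBasis κ ℂ K)
    {X Y : H →L[ℂ] K} (hX : Summable fun i => ‖X (b i)‖ ^ 2)
    (hY : Summable fun i => ‖Y (b i)‖ ^ 2) :
    HasSum (fun i => ⟪X (b i), Y (b i)⟫_ℂ) (∑' k, ⟪Y.adjoint (c k), X.adjoint (c k)⟫_ℂ) := by
  -- Absolute summability, from `|uv| ≤ |u|² + |v|²`, lets the double series of matrix entries be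
  -- summed in either order; Parseval evaluates the inner sums.
  have hs : Summable fun p : ι × κ => ⟪X (b p.1), c p.2⟫_ℂ * ⟪c p.2, Y (b p.1)⟫_ℂ := by
    refine Summable.of_norm_bounded
      ((summable_sq_norm_inner_prod b c hX).add (summable_sq_norm_inner_prod b c hY)) fun p => ?_
    rw [norm_mul, norm_inner_symm]
    nlinarith [sq_nonneg (‖⟪c p.2, X (b p.1)⟫_ℂ‖ - ‖⟪c p.2, Y (b p.1)⟫_ℂ‖),
      sq_nonneg (‖⟪c p.2, X (b p.1)⟫_ℂ‖ + ‖⟪c p.2, Y (b p.1)⟫_ℂ‖)]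
  have h1 := hs.hasSum.prod_fiberwise fun i => c.hasSum_inner_mul_inner (X (b i)) (Y (b i))
  have h2 := ((Equiv.prodComm κ ι).hasSum_iff.2 hs.hasSum).prod_fiberwise
    (g := fun k => ⟪Y.adjoint (c k), X.adjoint (c k)⟫_ℂ) fun k => by
      have h := b.hasSum_inner_mul_inner (Y.adjoint (c k)) (X.adjoint (c k))
      refine (congrArg (HasSum · _) (funext fun i => ?_)).mp h
      rw [ContinuousLinearMap.adjoint_inner_right, ContinuousLinearMap.adjoint_inner_left]
      exact mul_comm _ _
  rwa [h2.tsum_eq]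

end HilbertSchmidt

/-! ### Traces of `T D` for positive trace class `T`. -/

section Trace

variable {H ι : Type*} [NormedAddCommGroup H] [InnerProductSpace ℂ H] [CompleteSpace H]

theorem isPositive_sqrt (T : H →L[ℂ] H) : (CFC.sqrt T).IsPositive :=
  (ContinuousLinearMap.nonneg_iff_isPositive _).1 (CFC.sqrt_nonneg T)

theorem sqrt_sqrt_apply {T : H →L[ℂ] H} (hT : T.IsPositive) (x : H) :
    CFC.sqrt T (CFC.sqrt T x) = T x :=
  congrArg (fun S : H →L[ℂ] H => S x)
    (CFC.sqrt_mul_sqrt_self T ((ContinuousLinearMap.nonneg_iff_isPositive T).2 hT))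

theorem inner_sqrt_sqrt {T : H →L[ℂ] H} (hT : T.IsPositive) (x y : H) :
    ⟪CFC.sqrt T x, CFC.sqrt T y⟫_ℂ = ⟪x, T y⟫_ℂ := by
  rw [← sqrt_sqrt_apply hT y]
  exact (isPositive_sqrt T).isSymmetric x _

/-- For positive `T`, `|T| = T` and `⟪e, T e⟫ = ‖√T e‖²`, so `√T` is Hilbert–Schmidt. -/
theorem summable_sq_norm_sqrt {T : H →L[ℂ] H} (hT : T.IsPositive) (h : IsTraceClass T) :
    Summable fun i => ‖CFC.sqrt T (stdBasis H i)‖ ^ 2 := by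
  unfold IsTraceClass at h
  rw [CFC.abs_of_nonneg T ((ContinuousLinearMap.nonneg_iff_isPositive T).2 hT)] at h
  refine (Complex.hasSum_re h.hasSum).summable.congr fun i => ?_
  rw [← inner_sqrt_sqrt hT, inner_self_eq_norm_sq_to_K]
  norm_cast

/-- For a positive trace class `T` and a bounded `D`, the diagonal entries of `T D` have the same
sum in every orthonormal basis. -/
theorem hasSum_inner_comp {T : H →L[ℂ] H} (hT : T.IsPositive) (h : IsTraceClass T)
    (D : H →L[ℂ] H) (b : HilbertBasis ι ℂ H) :
    HasSum (fun i => ⟪b i, T (D (b i))⟫_ℂ)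
      (∑' j, ⟪CFC.sqrt T (stdBasis H j), D (CFC.sqrt T (stdBasis H j))⟫_ℂ) := by
  have hsa : (CFC.sqrt T).adjoint = CFC.sqrt T := (isPositive_sqrt T).isSelfAdjoint.adjoint_eq
  have hs := summable_sq_norm_sqrt hT h
  have hX : Summable fun i => ‖CFC.sqrt T (b i)‖ ^ 2 := by
    simpa only [hsa] using summable_sq_norm_adjoint (stdBasis H) b hs
  -- `√T D` is the adjoint of `D* √T`, whose Hilbert–Schmidt bound is immediate from the operator
  -- norm of `D*`.
  have hY : Summable fun i => ‖(CFC.sqrt T ∘L D) (b i)‖ ^ 2 := by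
    have h1 : Summable fun j => ‖(D.adjoint ∘L CFC.sqrt T) (stdBasis H j)‖ ^ 2 := by
      refine Summable.of_nonneg_of_le (fun _ => by positivity) (fun j => ?_)
        (hs.mul_left (‖D.adjoint‖ ^ 2))
      rw [← mul_pow]
      gcongr
      exact D.adjoint.le_opNorm _
    simpa only [ContinuousLinearMap.adjoint_comp, hsa, ContinuousLinearMap.adjoint_adjoint]
      using summable_sq_norm_adjoint (stdBasis H) b h1
  convert hasSum_inner_adjoint b (stdBasis H) hX hY using 1
  · ext i
    exact (inner_sqrt_sqrt hT _ _).symm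
  · refine tsum_congr fun j => ?_
    rw [ContinuousLinearMap.adjoint_comp, hsa, ContinuousLinearMap.comp_apply,
      ContinuousLinearMap.adjoint_inner_left]

theorem hasSum_trace_comp {T : H →L[ℂ] H} (hT : T.IsPositive) (h : IsTraceClass T)
    (D : H →L[ℂ] H) (b : HilbertBasis ι ℂ H) :
    HasSum (fun i => ⟪b i, T (D (b i))⟫_ℂ) (trace (T ∘L D)) := by
  have h1 := (hasSum_inner_comp hT h D (stdBasis H)).tsum_eq
  have h2 := hasSum_inner_comp hT h D b
  rwa [← h1] at h2

/-- `T D` itself need not be positive, but its trace is a sum of terms `⟪√T e, D √T e⟫ ≥ 0`. -/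
theorem trace_comp_nonneg {T : H →L[ℂ] H} (hT : T.IsPositive) (h : IsTraceClass T)
    {D : H →L[ℂ] H} (hD : D.IsPositive) : 0 ≤ trace (T ∘L D) := by
  rw [← (hasSum_trace_comp hT h D (stdBasis H)).tsum_eq,
    (hasSum_inner_comp hT h D (stdBasis H)).tsum_eq]
  exact tsum_nonneg fun j => hD.inner_nonneg_right _

theorem trace_comp_add {T : H →L[ℂ] H} (hT : T.IsPositive) (h : IsTraceClass T)
    (D D' : H →L[ℂ] H) : trace (T ∘L (D + D')) = trace (T ∘L D) + trace (T ∘L D') := by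
  refine (hasSum_trace_comp hT h _ (stdBasis H)).unique ?_
  simpa [inner_add_right] using
    (hasSum_trace_comp hT h D (stdBasis H)).add (hasSum_trace_comp hT h D' (stdBasis H))

theorem trace_comp_sub {T : H →L[ℂ] H} (hT : T.IsPositive) (h : IsTraceClass T)
    (D D' : H →L[ℂ] H) : trace (T ∘L (D - D')) = trace (T ∘L D) - trace (T ∘L D') := by
  refine (hasSum_trace_comp hT h _ (stdBasis H)).unique ?_
  simpa [inner_sub_right] using
    (hasSum_trace_comp hT h D (stdBasis H)).sub (hasSum_trace_comp hT h D' (stdBasis H))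

end Trace

/-! ### Partial traces and transfer of traces. -/

/-- A family of isometries with pairwise orthogonal ranges that together span the codomain. -/
structure IsOrthogonalResolution {κ F K : Type*}
    [NormedAddCommGroup F] [InnerProductSpace ℂ F] [CompleteSpace F]
    [NormedAddCommGroup K] [InnerProductSpace ℂ K] [CompleteSpace K]
    (V : κ → F →L[ℂ] K) : Prop where
  adjoint_comp_self : ∀ k, (V k).adjoint ∘L V k = .id ℂ F
  adjoint_comp_of_ne : ∀ k l, k ≠ l → (V k).adjoint ∘L V l = 0
  eq_zero_of_inner : ∀ v, (∀ k y, ⟪v, V k y⟫_ℂ = 0) → v = 0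

namespace IsOrthogonalResolution

variable {κ ι F K : Type*}
  [NormedAddCommGroup F] [InnerProductSpace ℂ F] [CompleteSpace F]
  [NormedAddCommGroup K] [InnerProductSpace ℂ K] [CompleteSpace K]
  {V : κ → F →L[ℂ] K}

theorem inner_self (hV : IsOrthogonalResolution V) (k : κ) (x y : F) :
    ⟪V k x, V k y⟫_ℂ = ⟪x, y⟫_ℂ := by
  rw [← ContinuousLinearMap.adjoint_inner_right, ← ContinuousLinearMap.comp_apply,
    hV.adjoint_comp_self]
  rfl

theorem inner_of_ne (hV : IsOrthogonalResolution V) {k l : κ} (h : k ≠ l) (x y : F) :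
    ⟪V k x, V l y⟫_ℂ = 0 := by
  rw [← ContinuousLinearMap.adjoint_inner_right, ← ContinuousLinearMap.comp_apply,
    hV.adjoint_comp_of_ne k l h, zero_apply, inner_zero_right]

theorem exists_hilbertBasis (hV : IsOrthogonalResolution V) (b : HilbertBasis ι ℂ F) :
    ∃ c : HilbertBasis (ι × κ) ℂ K, ∀ p, c p = V p.2 (b p.1) := by
  have ho : Orthonormal ℂ fun p : ι × κ => V p.2 (b p.1) := by
    classical
    rw [orthonormal_iff_ite]
    rintro ⟨i, k⟩ ⟨j, l⟩
    by_cases hkl : k = l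
    · subst hkl
      simp [hV.inner_self, orthonormal_iff_ite.1 b.orthonormal i j]
    · simp [hV.inner_of_ne hkl, hkl]
  refine ⟨HilbertBasis.mkOfOrthogonalEqBot ho ?_, fun p => by
    rw [HilbertBasis.coe_mkOfOrthogonalEqBot]⟩
  rw [Submodule.eq_bot_iff]
  intro v hv
  refine hV.eq_zero_of_inner v fun k y => ?_
  -- Orthogonality to the vectors `V k (b i)` for all `i` says that every coordinate of `(V k)* v`
  -- vanishes.
  have hz : (V k).adjoint v = 0 := by
    refine b.repr.injective ?_
    ext i
    rw [b.repr_apply_apply, ContinuousLinearMap.adjoint_inner_right, map_zero]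
    exact (Submodule.mem_orthogonal _ v).1 hv _ (Submodule.subset_span ⟨(i, k), rfl⟩)
  rw [← ContinuousLinearMap.adjoint_inner_left, hz, inner_zero_left]

/-- If `ρ` is the partial trace of `T`, then `tr (ρ D) = tr (T D')` whenever `D'` lifts `D`. -/
theorem hasSum_inner_comp (hV : IsOrthogonalResolution V) {T : K →L[ℂ] K} (hT : T.IsPositive)
    (hTc : IsTraceClass T) {ρ : F →L[ℂ] F} (hρ : ρ ≠ 0)
    (h : ∑' k, (V k).adjoint ∘L T ∘L V k = ρ) {D : F →L[ℂ] F} {D' : K →L[ℂ] K}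
    (hD : ∀ k, V k ∘L D = D' ∘L V k) (b : HilbertBasis ι ℂ F) :
    HasSum (fun i => ⟪b i, ρ (D (b i))⟫_ℂ) (trace (T ∘L D')) := by
  -- A non-summable `tsum` is 0 by convention, so `ρ ≠ 0` forces the partial trace to converge.
  have hs : Summable fun k => (V k).adjoint ∘L T ∘L V k := by
    by_contra hn
    exact hρ (h ▸ tsum_eq_zero_of_not_summable hn)
  have hρs : HasSum (fun k => (V k).adjoint ∘L T ∘L V k) ρ := h ▸ hs.hasSum
  obtain ⟨c, hc⟩ := hV.exists_hilbertBasis b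
  -- Expand `tr(T D')` in the basis `V k (b i)` and sum over `k` first; `D' V k = V k D` turns the
  -- inner sum into `⟪b i, ρ D (b i)⟫`.
  refine (hasSum_trace_comp hT hTc D' c).prod_fiberwise fun i => ?_
  have h1 := (hρs.mapL (ContinuousLinearMap.apply ℂ F (D (b i)))).mapL (innerSL ℂ (b i))
  refine (congrArg (HasSum · _) (funext fun k => ?_)).mp h1
  simp only [hc, ContinuousLinearMap.apply_apply, ContinuousLinearMap.comp_apply,
    innerSL_apply_apply, ContinuousLinearMap.adjoint_inner_right]
  exact congrArg (fun z => ⟪V k (b i), T z⟫_ℂ) (congrArg (fun S : F →L[ℂ] K => S (b i)) (hD k))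

end IsOrthogonalResolution

/-! ### Operators on the Hilbert space tensor product. -/

section Tensor

variable {E F E' F' E'' F'' G κ : Type*}
  [NormedAddCommGroup E] [InnerProductSpace ℂ E]
  [NormedAddCommGroup F] [InnerProductSpace ℂ F]
  [NormedAddCommGroup E'] [InnerProductSpace ℂ E']
  [NormedAddCommGroup F'] [InnerProductSpace ℂ F']
  [NormedAddCommGroup E''] [InnerProductSpace ℂ E'']
  [NormedAddCommGroup F''] [InnerProductSpace ℂ F'']
  [NormedAddCommGroup G] [InnerProductSpace ℂ G]

/-- The pure tensor `x ⊗ y` in the Hilbert space tensor product. -/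
def htmul (x : E) (y : F) : HTensor E F := ((x ⊗ₜ[ℂ] y : E ⊗[ℂ] F) : HTensor E F)

@[simp] theorem insertLeft_apply (x : E) (y : F) : insertLeft F x y = htmul x y := rfl

@[simp] theorem insertRight_apply (x : E) (y : F) : insertRight E y x = htmul x y := rfl

@[simp] theorem inner_htmul (x x' : E) (y y' : F) :
    ⟪htmul x y, htmul x' y'⟫_ℂ = ⟪x, x'⟫_ℂ * ⟪y, y'⟫_ℂ := by
  simp [htmul]

@[simp] theorem tensorOp_htmul (A : E →L[ℂ] E') (B : F →L[ℂ] F') (x : E) (y : F) :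
    tensorOp A B (htmul x y) = htmul (A x) (B y) := by
  simp [htmul, tensorOp]

/-- Pure tensors span a dense subspace. -/
theorem hTensor_hom_ext {f g : HTensor E F →L[ℂ] G}
    (h : ∀ x y, f (htmul x y) = g (htmul x y)) : f = g := by
  ext v
  induction v using UniformSpace.Completion.induction_on with
  | hp => exact isClosed_eq f.continuous g.continuous
  | ih a =>
    induction a using TensorProduct.induction_on with
    | zero => rw [UniformSpace.Completion.coe_zero, map_zero, map_zero]
    | tmul x y => exact h x y
    | add a b ha hb => rw [UniformSpace.Completion.coe_add, map_add, map_add, ha, hb]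

theorem eq_zero_of_inner_htmul {v : HTensor E F} (h : ∀ x y, ⟪v, htmul x y⟫_ℂ = 0) : v = 0 := by
  have h0 : innerSL ℂ v = 0 := hTensor_hom_ext fun x y => by simpa using h x y
  rw [← inner_self_eq_zero (𝕜 := ℂ), ← innerSL_apply_apply, h0, zero_apply]

theorem tensorOp_comp (A : E' →L[ℂ] E'') (A' : E →L[ℂ] E') (B : F' →L[ℂ] F'') (B' : F →L[ℂ] F') :
    tensorOp A B ∘L tensorOp A' B' = tensorOp (A ∘L A') (B ∘L B') :=
  hTensor_hom_ext fun x y => by simp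

theorem htmul_add_left (x x' : E) (y : F) : htmul (x + x') y = htmul x y + htmul x' y :=
  map_add (insertRight E y) x x'

theorem htmul_add_right (x : E) (y y' : F) : htmul x (y + y') = htmul x y + htmul x y' :=
  map_add (insertLeft F x) y y'

theorem htmul_sub_left (x x' : E) (y : F) : htmul (x - x') y = htmul x y - htmul x' y :=
  map_sub (insertRight E y) x x'

theorem htmul_sub_right (x : E) (y y' : F) : htmul x (y - y') = htmul x y - htmul x y' :=
  map_sub (insertLeft F x) y y'

theorem htmul_zero_left (y : F) : htmul (0 : E) y = 0 := map_zero (insertRight E y)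

theorem htmul_zero_right (x : E) : htmul x (0 : F) = 0 := map_zero (insertLeft F x)

theorem tensorOp_add_left (A A' : E →L[ℂ] E') (B : F →L[ℂ] F') :
    tensorOp (A + A') B = tensorOp A B + tensorOp A' B :=
  hTensor_hom_ext fun x y => by simp [htmul_add_left]

theorem tensorOp_add_right (A : E →L[ℂ] E') (B B' : F →L[ℂ] F') :
    tensorOp A (B + B') = tensorOp A B + tensorOp A B' :=
  hTensor_hom_ext fun x y => by simp [htmul_add_right]

theorem tensorOp_sub_left (A A' : E →L[ℂ] E') (B : F →L[ℂ] F') :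
    tensorOp (A - A') B = tensorOp A B - tensorOp A' B :=
  hTensor_hom_ext fun x y => by simp [htmul_sub_left]

theorem tensorOp_sub_right (A : E →L[ℂ] E') (B B' : F →L[ℂ] F') :
    tensorOp A (B - B') = tensorOp A B - tensorOp A B' :=
  hTensor_hom_ext fun x y => by simp [htmul_sub_right]

theorem tensorOp_id : tensorOp (.id ℂ E) (.id ℂ F) = .id ℂ (HTensor E F) :=
  hTensor_hom_ext fun x y => by simp

theorem tensorOp_zero_left (B : F →L[ℂ] F') : tensorOp (0 : E →L[ℂ] E') B = 0 :=
  hTensor_hom_ext fun x y => by simp [htmul_zero_left]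

theorem tensorOp_zero_right (A : E →L[ℂ] E') : tensorOp A (0 : F →L[ℂ] F') = 0 :=
  hTensor_hom_ext fun x y => by simp [htmul_zero_right]

theorem adjoint_insertLeft_comp [CompleteSpace F] (e f : E) :
    (insertLeft F e).adjoint ∘L insertLeft F f = ⟪e, f⟫_ℂ • .id ℂ F := by
  ext y
  refine ext_inner_left ℂ fun x => ?_
  simp [ContinuousLinearMap.adjoint_inner_right, inner_smul_right]

theorem adjoint_insertRight_comp [CompleteSpace E] (e f : F) :
    (insertRight E e).adjoint ∘L insertRight E f = ⟪e, f⟫_ℂ • .id ℂ E := by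
  ext y
  refine ext_inner_left ℂ fun x => ?_
  simp [ContinuousLinearMap.adjoint_inner_right, inner_smul_right, mul_comm]

theorem hilbertBasis_eq_zero_of_inner (b : HilbertBasis κ ℂ E) {v : E}
    (h : ∀ k, ⟪v, b k⟫_ℂ = 0) : v = 0 := by
  refine b.repr.injective ?_
  ext k
  rw [b.repr_apply_apply, map_zero, ← inner_conj_symm, h k, map_zero]
  rfl

variable [CompleteSpace E] [CompleteSpace F] [CompleteSpace E'] [CompleteSpace F']

theorem adjoint_tensorOp (A : E →L[ℂ] E') (B : F →L[ℂ] F') :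
    (tensorOp A B).adjoint = tensorOp A.adjoint B.adjoint :=
  hTensor_hom_ext fun x y => by
    refine sub_eq_zero.1 (eq_zero_of_inner_htmul fun x' y' => ?_)
    rw [inner_sub_left, ContinuousLinearMap.adjoint_inner_left]
    simp [ContinuousLinearMap.adjoint_inner_left]

/-- `A ⊗ B = S* S` with `S = √A ⊗ √B`. -/
theorem isPositive_tensorOp {A : E →L[ℂ] E} {B : F →L[ℂ] F} (hA : A.IsPositive)
    (hB : B.IsPositive) : (tensorOp A B).IsPositive := by
  have key : tensorOp A B = (tensorOp (CFC.sqrt A) (CFC.sqrt B)).adjoint ∘L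
      tensorOp (CFC.sqrt A) (CFC.sqrt B) := by
    rw [adjoint_tensorOp, tensorOp_comp, (isPositive_sqrt A).isSelfAdjoint.adjoint_eq,
      (isPositive_sqrt B).isSelfAdjoint.adjoint_eq]
    congr 1 <;> ext x <;> simp [sqrt_sqrt_apply, hA, hB]
  rw [key]
  exact ContinuousLinearMap.isPositive_adjoint_comp_self _

theorem isOrthogonalResolution_insertLeft (b : HilbertBasis κ ℂ E) :
    IsOrthogonalResolution fun k => insertLeft F (b k) where
  adjoint_comp_self k := by
    rw [adjoint_insertLeft_comp, inner_self_eq_norm_sq_to_K, b.orthonormal.1 k]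
    simp
  adjoint_comp_of_ne k l h := by rw [adjoint_insertLeft_comp, b.orthonormal.2 h, zero_smul]
  eq_zero_of_inner v h := eq_zero_of_inner_htmul fun x y => by
    have : (insertRight E y).adjoint v = 0 := hilbertBasis_eq_zero_of_inner b fun k => by
      rw [ContinuousLinearMap.adjoint_inner_left]
      exact h k y
    rw [← insertRight_apply, ← ContinuousLinearMap.adjoint_inner_left, this, inner_zero_left]

theorem isOrthogonalResolution_insertRight (b : HilbertBasis κ ℂ F) :
    IsOrthogonalResolution fun k => insertRight E (b k) where
  adjoint_comp_self k := by
    rw [adjoint_insertRight_comp, inner_self_eq_norm_sq_to_K, b.orthonormal.1 k]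
    simp
  adjoint_comp_of_ne k l h := by rw [adjoint_insertRight_comp, b.orthonormal.2 h, zero_smul]
  eq_zero_of_inner v h := eq_zero_of_inner_htmul fun x y => by
    have : (insertLeft F x).adjoint v = 0 := hilbertBasis_eq_zero_of_inner b fun k => by
      rw [ContinuousLinearMap.adjoint_inner_left]
      exact h k x
    rw [← insertLeft_apply, ← ContinuousLinearMap.adjoint_inner_left, this, inner_zero_left]

/-- Completeness is checked by slicing: for fixed `x`, the adjoint of `y ↦ x ⊗ y` sends `v` to a
vector orthogonal to all ranges of `V`. -/
theorem IsOrthogonalResolution.tensorOp_id_left {V : κ → F →L[ℂ] F'}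
    (hV : IsOrthogonalResolution V) :
    IsOrthogonalResolution fun k => tensorOp (.id ℂ E) (V k) where
  adjoint_comp_self k := by
    rw [adjoint_tensorOp, tensorOp_comp, hV.adjoint_comp_self, ContinuousLinearMap.adjoint_id,
      ContinuousLinearMap.comp_id, tensorOp_id]
  adjoint_comp_of_ne k l h := by
    rw [adjoint_tensorOp, tensorOp_comp, hV.adjoint_comp_of_ne k l h, tensorOp_zero_right]
  eq_zero_of_inner v h := eq_zero_of_inner_htmul fun x y => by
    have : (insertLeft F' x).adjoint v = 0 := hV.eq_zero_of_inner _ fun k z => by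
      rw [ContinuousLinearMap.adjoint_inner_left]
      simpa using h k (htmul x z)
    rw [← insertLeft_apply, ← ContinuousLinearMap.adjoint_inner_left, this, inner_zero_left]

theorem IsOrthogonalResolution.tensorOp_id_right {V : κ → E →L[ℂ] E'}
    (hV : IsOrthogonalResolution V) :
    IsOrthogonalResolution fun k => tensorOp (V k) (.id ℂ F) where
  adjoint_comp_self k := by
    rw [adjoint_tensorOp, tensorOp_comp, hV.adjoint_comp_self, ContinuousLinearMap.adjoint_id,
      ContinuousLinearMap.comp_id, tensorOp_id]
  adjoint_comp_of_ne k l h := by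
    rw [adjoint_tensorOp, tensorOp_comp, hV.adjoint_comp_of_ne k l h, tensorOp_zero_left]
  eq_zero_of_inner v h := eq_zero_of_inner_htmul fun x y => by
    have : (insertRight E' y).adjoint v = 0 := hV.eq_zero_of_inner _ fun k z => by
      rw [ContinuousLinearMap.adjoint_inner_left]
      simpa using h k (htmul z y)
    rw [← insertRight_apply, ← ContinuousLinearMap.adjoint_inner_left, this, inner_zero_left]

end Tensor

/-! ### The CHSH bound. -/

section CHSH

/-- The value of the CHSH expression, from the values of its four terms. -/
theorem hasSum_chsh {H₁ H₂ ι : Type*}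
    [NormedAddCommGroup H₁] [InnerProductSpace ℂ H₁]
    [NormedAddCommGroup H₂] [InnerProductSpace ℂ H₂]
    {ρ : HTensor H₁ H₂ →L[ℂ] HTensor H₁ H₂}
    {A₁ A₂ : H₁ →L[ℂ] H₁} {B₁ B₂ : H₂ →L[ℂ] H₂} (b : HilbertBasis ι ℂ (HTensor H₁ H₂))
    {t₁₁ t₁₂ t₂₁ t₂₂ : ℂ}
    (h₁₁ : HasSum (fun i => ⟪b i, ρ (tensorOp A₁ B₁ (b i))⟫_ℂ) t₁₁)
    (h₁₂ : HasSum (fun i => ⟪b i, ρ (tensorOp A₁ B₂ (b i))⟫_ℂ) t₁₂)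
    (h₂₁ : HasSum (fun i => ⟪b i, ρ (tensorOp A₂ B₁ (b i))⟫_ℂ) t₂₁)
    (h₂₂ : HasSum (fun i => ⟪b i, ρ (tensorOp A₂ B₂ (b i))⟫_ℂ) t₂₂) :
    HasSum (fun i => ⟪b i, (ρ ∘L chshOp A₁ A₂ B₁ B₂) (b i)⟫_ℂ) (t₁₁ + t₁₂ + t₂₁ - t₂₂) := by
  simpa [chshOp, inner_add_right, inner_sub_right] using ((h₁₁.add h₁₂).add h₂₁).sub h₂₂

variable {E F G H₁ H₂ : Type*}
  [NormedAddCommGroup E] [InnerProductSpace ℂ E] [CompleteSpace E]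
  [NormedAddCommGroup F] [InnerProductSpace ℂ F] [CompleteSpace F]
  [NormedAddCommGroup G] [InnerProductSpace ℂ G] [CompleteSpace G]
  [NormedAddCommGroup H₁] [InnerProductSpace ℂ H₁] [CompleteSpace H₁]
  [NormedAddCommGroup H₂] [InnerProductSpace ℂ H₂] [CompleteSpace H₂]

theorem IsUnitObservable.isPositive_id_sub {A : E →L[ℂ] E} (hA : IsUnitObservable A) :
    (.id ℂ E - A : E →L[ℂ] E).IsPositive := by
  rw [ContinuousLinearMap.isPositive_def']
  refine ⟨(IsSelfAdjoint.one (E →L[ℂ] E)).sub hA.isSelfAdjoint, fun x => ?_⟩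
  have h1 : RCLike.re ⟪A x, x⟫_ℂ ≤ ‖x‖ * ‖x‖ :=
    (re_inner_le_norm _ _).trans (by
      gcongr
      simpa using A.le_of_opNorm_le hA.norm_le_one x)
  have h2 := inner_self_eq_norm_mul_norm (𝕜 := ℂ) x
  simp only [ContinuousLinearMap.reApplyInnerSelf_apply, sub_apply,
    ContinuousLinearMap.id_apply, inner_sub_left, map_sub]
  linarith

theorem IsUnitObservable.isPositive_id_add {A : E →L[ℂ] E} (hA : IsUnitObservable A) :
    (.id ℂ E + A : E →L[ℂ] E).IsPositive := by
  have h : IsUnitObservable (-A) := ⟨hA.isSelfAdjoint.neg, by simpa using hA.norm_le_one⟩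
  simpa only [sub_neg_eq_add] using h.isPositive_id_sub

/-- The CHSH inequality for a positive normalized functional on three commuting factors. -/
theorem norm_chsh_le_two (g : (E →L[ℂ] E) → (F →L[ℂ] F) → (G →L[ℂ] G) → ℂ)
    (add₁ : ∀ a a' x y, g (a + a') x y = g a x y + g a' x y)
    (sub₁ : ∀ a a' x y, g (a - a') x y = g a x y - g a' x y)
    (add₂ : ∀ a x x' y, g a (x + x') y = g a x y + g a x' y)
    (sub₂ : ∀ a x x' y, g a (x - x') y = g a x y - g a x' y)
    (add₃ : ∀ a x y y', g a x (y + y') = g a x y + g a x y')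
    (sub₃ : ∀ a x y y', g a x (y - y') = g a x y - g a x y')
    (nonneg : ∀ a x y, a.IsPositive → x.IsPositive → y.IsPositive → 0 ≤ g a x y)
    (one : g (.id ℂ E) (.id ℂ F) (.id ℂ G) = 1)
    {a₁ a₂ : E →L[ℂ] E} {x : F →L[ℂ] F} {y : G →L[ℂ] G}
    (ha₁ : IsUnitObservable a₁) (ha₂ : IsUnitObservable a₂)
    (hx : IsUnitObservable x) (hy : IsUnitObservable y) :
    ‖g a₁ x (.id ℂ G) + g a₁ (.id ℂ F) y + g a₂ x (.id ℂ G) - g a₂ (.id ℂ F) y‖ ≤ 2 := by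
  set w := g a₁ x (.id ℂ G) + g a₁ (.id ℂ F) y + g a₂ x (.id ℂ G) - g a₂ (.id ℂ F) y with hw
  have hx₁ := hx.isPositive_id_add
  have hx₂ := hx.isPositive_id_sub
  have hy₁ := hy.isPositive_id_add
  have hy₂ := hy.isPositive_id_sub
  -- The terms with `a₁` add up to `2 + 2xy - 2a₁(x + y)`, those with `a₂` to `2 - 2xy - 2a₂(x -
  -- y)`; the `xy` terms cancel. `h2` is the same with the signs of `a₁`, `a₂` reversed.
  have h1 := add_nonneg
    (add_nonneg (nonneg _ _ _ ha₁.isPositive_id_sub hx₁ hy₁)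
      (nonneg _ _ _ ha₁.isPositive_id_add hx₂ hy₂))
    (add_nonneg (nonneg _ _ _ ha₂.isPositive_id_sub hx₁ hy₂)
      (nonneg _ _ _ ha₂.isPositive_id_add hx₂ hy₁))
  have h2 := add_nonneg
    (add_nonneg (nonneg _ _ _ ha₁.isPositive_id_add hx₁ hy₁)
      (nonneg _ _ _ ha₁.isPositive_id_sub hx₂ hy₂))
    (add_nonneg (nonneg _ _ _ ha₂.isPositive_id_add hx₁ hy₂)
      (nonneg _ _ _ ha₂.isPositive_id_sub hx₂ hy₁))
  simp only [add₁, sub₁, add₂, sub₂, add₃, sub₃, one] at h1 h2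
  have h1' : 0 ≤ 4 - 2 * w := by
    convert h1 using 1
    rw [hw]
    ring
  have h2' : 0 ≤ 4 + 2 * w := by
    convert h2 using 1
    rw [hw]
    ring
  -- Nonnegativity in `ℂ` includes vanishing imaginary part, so `w` is real.
  rw [Complex.nonneg_iff] at h1' h2'
  obtain ⟨hr, hi⟩ := h1'
  obtain ⟨hr', -⟩ := h2'
  simp at hr hi hr'
  have hw' : w = (w.re : ℂ) := Complex.ext rfl (by simpa using hi)
  rw [hw', Complex.norm_real, Real.norm_eq_abs, abs_le]
  constructor <;> linarith

/-- Excludes the default value 0 of a divergent partial trace. -/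
theorem IsState.ne_zero {ρ : E →L[ℂ] E} (hρ : IsState ρ) : ρ ≠ 0 := by
  rintro rfl
  simpa [trace] using hρ.trace_eq_one

theorem hasTrace_trace_of_hasSum {T : E →L[ℂ] E} {t : ℂ} (h : HasTrace T t) :
    HasTrace T (trace T) ∧ trace T = t := by
  have ht : trace T = t := (h _ (stdBasis E)).tsum_eq
  exact ⟨ht ▸ h, ht⟩

variable {ρ : HTensor H₁ H₂ →L[ℂ] HTensor H₁ H₂} {A₁ A₂ : H₁ →L[ℂ] H₁} {B₁ B₂ : H₂ →L[ℂ] H₂}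

theorem IsSourceOp122.chsh (hρ : IsState ρ) {T : K122 H₁ H₂ →L[ℂ] K122 H₁ H₂}
    (hTρ : IsSourceOp122 ρ T) (hT : T.IsPositive)
    (hA₁ : IsUnitObservable A₁) (hA₂ : IsUnitObservable A₂)
    (hB₁ : IsUnitObservable B₁) (hB₂ : IsUnitObservable B₂) :
    ∃ t, HasTrace (ρ ∘L chshOp A₁ A₂ B₁ B₂) t ∧ ‖t‖ ≤ 2 := by
  have hTc := hTρ.isTraceClass
  have left {ι} (b : HilbertBasis ι ℂ (HTensor H₁ H₂)) (A : H₁ →L[ℂ] H₁) (B : H₂ →L[ℂ] H₂) :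
      HasSum (fun i => ⟪b i, ρ (tensorOp A B (b i))⟫_ℂ)
        (trace (T ∘L tensorOp A (tensorOp (.id ℂ H₂) B))) :=
    (isOrthogonalResolution_insertLeft (stdBasis H₂)).tensorOp_id_left.hasSum_inner_comp hT hTc
      hρ.ne_zero hTρ.ptrace_two (fun k => hTensor_hom_ext fun x y => by simp) b
  have right {ι} (b : HilbertBasis ι ℂ (HTensor H₁ H₂)) (A : H₁ →L[ℂ] H₁) (B : H₂ →L[ℂ] H₂) :
      HasSum (fun i => ⟪b i, ρ (tensorOp A B (b i))⟫_ℂ)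
        (trace (T ∘L tensorOp A (tensorOp B (.id ℂ H₂)))) :=
    (isOrthogonalResolution_insertRight (stdBasis H₂)).tensorOp_id_left.hasSum_inner_comp hT hTc
      hρ.ne_zero hTρ.ptrace_three (fun k => hTensor_hom_ext fun x y => by simp) b
  -- `B₁` always acts on the second factor and `B₂` on the third, so the two commute.
  refine ⟨_, fun ι b => hasSum_chsh b (right b A₁ B₁) (left b A₁ B₂) (right b A₂ B₁)
    (left b A₂ B₂), ?_⟩
  refine norm_chsh_le_two (fun a x y => trace (T ∘L tensorOp a (tensorOp x y)))
    ?_ ?_ ?_ ?_ ?_ ?_ (fun a x y ha hx hy => trace_comp_nonneg hT hTc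
      (isPositive_tensorOp ha (isPositive_tensorOp hx hy))) ?_ hA₁ hA₂ hB₁ hB₂
  any_goals
    intros
    simp only [tensorOp_add_left, tensorOp_add_right, tensorOp_sub_left, tensorOp_sub_right,
      trace_comp_add hT hTc, trace_comp_sub hT hTc]
  -- Normalization: the transfer formula with identity observables gives `tr T = tr ρ = 1`.
  rw [← hρ.trace_eq_one, ← (left (stdBasis _) (.id ℂ H₁) (.id ℂ H₂)).tsum_eq, tensorOp_id]
  rfl

theorem IsSourceOp112.chsh (hρ : IsState ρ) {T : K112 H₁ H₂ →L[ℂ] K112 H₁ H₂}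
    (hTρ : IsSourceOp112 ρ T) (hT : T.IsPositive)
    (hA₁ : IsUnitObservable A₁) (hA₂ : IsUnitObservable A₂)
    (hB₁ : IsUnitObservable B₁) (hB₂ : IsUnitObservable B₂) :
    ∃ t, HasTrace (ρ ∘L chshOp A₁ A₂ B₁ B₂) t ∧ ‖t‖ ≤ 2 := by
  have hTc := hTρ.isTraceClass
  have left {ι} (b : HilbertBasis ι ℂ (HTensor H₁ H₂)) (A : H₁ →L[ℂ] H₁) (B : H₂ →L[ℂ] H₂) :
      HasSum (fun i => ⟪b i, ρ (tensorOp A B (b i))⟫_ℂ)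
        (trace (T ∘L tensorOp (tensorOp (.id ℂ H₁) A) B)) :=
    (isOrthogonalResolution_insertLeft (stdBasis H₁)).tensorOp_id_right.hasSum_inner_comp hT hTc
      hρ.ne_zero hTρ.ptrace_one (fun k => hTensor_hom_ext fun x y => by simp) b
  have right {ι} (b : HilbertBasis ι ℂ (HTensor H₁ H₂)) (A : H₁ →L[ℂ] H₁) (B : H₂ →L[ℂ] H₂) :
      HasSum (fun i => ⟪b i, ρ (tensorOp A B (b i))⟫_ℂ)
        (trace (T ∘L tensorOp (tensorOp A (.id ℂ H₁)) B)) :=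
    (isOrthogonalResolution_insertRight (stdBasis H₁)).tensorOp_id_right.hasSum_inner_comp hT hTc
      hρ.ne_zero hTρ.ptrace_two (fun k => hTensor_hom_ext fun x y => by simp) b
  refine ⟨_, fun ι b => hasSum_chsh b (right b A₁ B₁) (right b A₁ B₂) (left b A₂ B₁)
    (left b A₂ B₂), ?_⟩
  -- Here `A₁`, `A₂` occupy the separate factors, so the CHSH form is read with the two sides
  -- exchanged, which swaps its middle terms.
  rw [add_right_comm]
  refine norm_chsh_le_two (fun b x y => trace (T ∘L tensorOp (tensorOp x y) b))
    ?_ ?_ ?_ ?_ ?_ ?_ (fun b x y hb hx hy => trace_comp_nonneg hT hTc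
      (isPositive_tensorOp (isPositive_tensorOp hx hy) hb)) ?_ hB₁ hB₂ hA₁ hA₂
  any_goals
    intros
    simp only [tensorOp_add_left, tensorOp_add_right, tensorOp_sub_left, tensorOp_sub_right,
      trace_comp_add hT hTc, trace_comp_sub hT hTc]
  rw [← hρ.trace_eq_one, ← (left (stdBasis _) (.id ℂ H₁) (.id ℂ H₂)).tsum_eq, tensorOp_id]
  rfl

end CHSH

end DSO

end


theorem theorem1 {H₁ : Type*} {H₂ : Type*}
    [NormedAddCommGroup H₁] [InnerProductSpace ℂ H₁] [CompleteSpace H₁]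
    [TopologicalSpace.SeparableSpace H₁]
    [NormedAddCommGroup H₂] [InnerProductSpace ℂ H₂] [CompleteSpace H₂]
    [TopologicalSpace.SeparableSpace H₂]
    (ρ : DSO.HTensor H₁ H₂ →L[ℂ] DSO.HTensor H₁ H₂) (hρ : DSO.IsDSOState ρ)
    (A₁ A₂ : H₁ →L[ℂ] H₁) (B₁ B₂ : H₂ →L[ℂ] H₂)
    (hA₁ : DSO.IsUnitObservable A₁) (hA₂ : DSO.IsUnitObservable A₂)
    (hB₁ : DSO.IsUnitObservable B₁) (hB₂ : DSO.IsUnitObservable B₂) :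
    DSO.HasTrace (ρ ∘L DSO.chshOp A₁ A₂ B₁ B₂) (DSO.trace (ρ ∘L DSO.chshOp A₁ A₂ B₁ B₂)) ∧
      ‖DSO.trace (ρ ∘L DSO.chshOp A₁ A₂ B₁ B₂)‖ ≤ 2 := by
  obtain ⟨t, ht, hle⟩ : ∃ t, DSO.HasTrace (ρ ∘L DSO.chshOp A₁ A₂ B₁ B₂) t ∧ ‖t‖ ≤ 2 := by
    rcases hρ.exists_density with ⟨T, hTρ, hT⟩ | ⟨T, hTρ, hT⟩
    · exact hTρ.chsh hρ.isState hT hA₁ hA₂ hB₁ hB₂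
    · exact hTρ.chsh hρ.isState hT hA₁ hA₂ hB₁ hB₂
  obtain ⟨h, heq⟩ := DSO.hasTrace_trace_of_hasSum ht
  exact ⟨h, heq ▸ hle⟩
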